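/- Let $\mathbb M_n$ be the algebra of complex $n\times n$ matrices, $\Re X=\frac{X+X^*}{2}$ for $X\in\mathbb M_n$, and let $\le$ denote the Loewner order on $\mathbb M_n$ and the usual order on the self-adjoint elements of a $C^*$-algebra. For $\alpha\in[0,\frac{\pi}{2})$ put $S_\alpha=\{z\in\mathbb C:\ \Re z>0,\ |\Im z|\le(\Re z)\tan\alpha\}$, and let $W(X)=\{x^*Xx:\ x\in\mathbb C^n,\ x^*x=1\}$ be the numerical range of $X$. Let $\alpha\in[0,\frac{\pi}{2})$, let $A,B\in\mathbb M_n$ satisfy $W(A),W(B)\subset S_\alpha$, and let $0\le v\le 1$. Write $$A\nabla_vB=(1-v)A+vB,\qquad A!_vB=\bigl((1-v)A^{-1}+vB^{-1}\bigr)^{-1},$$ $$A\sharp_vB=\frac{\sin v\pi}{\pi}\int_0^\infty s^{v-1}(A^{-1}+sB^{-1})^{-1}\,ds\quad(0<v<1),\qquad A\sharp_0B=A,\quad A\sharp_1B=B$$ (the values at $v=0,1$ are the limits of the integral expression). Let $0<m\le M$, $h=M/m$, and let $K(h)=\frac{(h+1)^2}{4h}$ be the Kantorovich constant. Let $\mathcal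 A$ be a unital $C^*$-algebra (for example $\mathbb M_k$ or the bounded operators on a Hilbert space), and let $\Phi:\mathbb M_n\to\mathcal A$ be a positive unital linear map; write $\Phi^2(X)=(\Phi(X))^2$. Then: (i) If $mI_n\le\Re(A^{-1})\le MI_n$ and $mI_n\le\Re(B^{-1})\le MI_n$, then $$\Phi^2\bigl(\Re(A\sharp_vB)\bigr)\le\sec^8(\alpha)\,K^2(h)\,\Phi^2\bigl(\Re(A!_vB)\bigr).$$ (ii) If $mI_n\le\Re A\le MI_n$ and $mI_n\le\Re B\le MI_n$, then $$K^{-2}(h)\cos^8(\alpha)\,\Phi^2\bigl(\Re(A\nabla_vB)\bigr)\le\Phi^2\bigl(\Re(A\sharp_vB)\bigr).$$ -/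

import Mathlib

open scoped MatrixOrder ComplexStarModule

noncomputable section

namespace SectorMatrix

/-- The sector `S_α = {z : Re z > 0, |Im z| ≤ (Re z) tan α}` of the complex plane. -/
def sector (α : ℝ) : Set ℂ :=
  {z | 0 < z.re ∧ |z.im| ≤ z.re * Real.tan α}

/-- The numerical range `W(A) = {x* A x : x ∈ ℂⁿ, x* x = 1}`. -/
def numericalRange {n : ℕ} (A : Matrix (Fin n) (Fin n) ℂ) : Set ℂ :=
  {z | ∃ x : Fin n → ℂ, star x ⬝ᵥ x = 1 ∧ star x ⬝ᵥ A.mulVec x = z}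

/-- The weighted arithmetic mean `A ∇_v B = (1 - v) A + v B`. -/
def arithMean {n : ℕ} (v : ℝ) (A B : Matrix (Fin n) (Fin n) ℂ) :
    Matrix (Fin n) (Fin n) ℂ :=
  (1 - v) • A + v • B

/-- The weighted harmonic mean `A !_v B = ((1 - v) A⁻¹ + v B⁻¹)⁻¹`. -/
def harmMean {n : ℕ} (v : ℝ) (A B : Matrix (Fin n) (Fin n) ℂ) :
    Matrix (Fin n) (Fin n) ℂ :=
  ((1 - v) • A⁻¹ + v • B⁻¹)⁻¹

/-- The weighted geometric mean of accretive matrices,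
`A ♯_v B = (sin (v π) / π) ∫_0^∞ s^(v-1) (A⁻¹ + s B⁻¹)⁻¹ ds` for `0 < v < 1`, the matrix-valued
integral being taken entrywise. At `v = 0` and `v = 1`, where the integral diverges, the value
is the limit of that expression as `v → 0+` and `v → 1-`, namely `A` and `B`. -/
def geomMean {n : ℕ} (v : ℝ) (A B : Matrix (Fin n) (Fin n) ℂ) :
    Matrix (Fin n) (Fin n) ℂ :=
  if v = 0 then A
  else if v = 1 then B
  else (Real.sin (v * Real.pi) / Real.pi) •
    Matrix.of fun i j =>
      ∫ s in Set.Ioi (0 : ℝ), (s ^ (v - 1) • (A⁻¹ + s • B⁻¹)⁻¹) i j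

/-- The Kantorovich constant `K(h) = (h + 1)² / (4 h)`. -/
def kantorovich (h : ℝ) : ℝ := (h + 1) ^ 2 / (4 * h)

end SectorMatrix

end

open SectorMatrix

/-! ### Elements with strictly positive real part. -/

section Accretive

open Ring

/-! Both inequalities reduce to `a • P + b • Q⁻¹ ≤ c • 1` for `P`, `Q` the images under `Φ` of the
two real parts. By the Bhatia–Kittaneh bound (`norm_mul_le_one_div_four`), this gives `‖P * Q⁻¹‖ ≤
c² / (4ab)`, which is an inequality between squares; a bare `P ≤ k • Q` would not square.

The linear inequality is found among matrices, then moved through `Φ` by Choi's inequality `Φ(T)⁻¹ ≤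
Φ(T⁻¹)`. Its source is `T + mM T⁻¹ ≤ m + M` for `m ≤ T ≤ M`, averaged with weights `1 - v`, `v` over
`T = ℜA, ℜB` in (ii) and `T = ℜA⁻¹, ℜB⁻¹` in (i).

The geometric mean enters through two bounds obtained by integrating resolvent estimates: `ℜ(A ♯ B)`
is at least the harmonic mean of `ℜA, ℜB`, and at most the arithmetic mean of `(ℜA⁻¹)⁻¹, (ℜB⁻¹)⁻¹`.
Neither costs a power of `sec α`. Sectoriality supplies a constant only in (i), where `(ℜX⁻¹)⁻¹ ≤
sec²α ℜX` is applied to `X = (1 - v)A⁻¹ + vB⁻¹`. The proof thus yields `sec⁴α K²` in (i) and `K²` in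
(ii); the stated eighth powers are weaker. -/

theorem realPart_star_coe {E : Type*} [AddCommGroup E] [Module ℂ E] [StarAddMonoid E]
    [StarModule ℂ E] (a : E) : (ℜ (star a) : E) = ℜ a := by
  simp [realPart_apply_coe, add_comm]

variable {E : Type*} [CStarAlgebra E] [PartialOrder E] [StarOrderedRing E]

theorem isStrictlyPositive_of_smul_one_le {ε : ℝ} (hε : 0 < ε) {a : E} (h : ε • (1 : E) ≤ a) :
    IsStrictlyPositive a :=
  (isStrictlyPositive_one.smul hε).of_le h

theorem ringInverse_smul_one {E : Type*} [Ring E] [Algebra ℝ E] {ε : ℝ} (hε : ε ≠ 0) : (ε • (1 : E))⁻¹ʳ = ε⁻¹ • (1 : E) := by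
  have h : (ε • (1 : E)) * (ε⁻¹ • 1) = 1 := by simp [hε]
  have hu : IsUnit (ε • (1 : E)) :=
    isUnit_iff_exists.2 ⟨_, h, by simp [hε]⟩
  rw [← Ring.inverse_mul_cancel_left _ (ε⁻¹ • (1 : E)) hu, h, mul_one]

theorem IsStrictlyPositive.exists_smul_one_le {a : E} (ha : IsStrictlyPositive a) :
    ∃ ε : ℝ, 0 < ε ∧ ε • (1 : E) ≤ a := by
  -- The `+ 1` keeps the bound positive even when the algebra is trivial.
  have h1 : a⁻¹ʳ ≤ (‖a⁻¹ʳ‖ + 1) • (1 : E) := by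
    refine (IsSelfAdjoint.le_algebraMap_norm_self ha.ringInverse.isSelfAdjoint).trans ?_
    rw [Algebra.algebraMap_eq_smul_one]
    exact smul_le_smul_of_nonneg_right (by linarith) zero_le_one
  have h2 := CStarAlgebra.ringInverse_le_ringInverse h1 ha.ringInverse
  rw [Ring.inverse_inverse ha.isUnit, ringInverse_smul_one (by positivity)] at h2
  exact ⟨_, by positivity, h2⟩

/-- `a*a - ε² = (a - ε)*(a - ε) + 2ε(ℜa - ε)`. Applied to `a` and to its adjoint it makes `a`
invertible; it also bounds the norm of the inverse by `1/ε`. -/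
theorem smul_one_le_star_mul_self {a : E} {ε : ℝ} (hε : 0 ≤ ε) (h : ε • (1 : E) ≤ ℜ a) :
    (ε ^ 2) • (1 : E) ≤ star a * a := by
  have h1 : 0 ≤ star (a - ε • (1 : E)) * (a - ε • (1 : E)) := star_mul_self_nonneg _
  have h2 : 0 ≤ (2 * ε) • ((ℜ a : E) - ε • (1 : E)) :=
    smul_nonneg (by positivity) (sub_nonneg.2 h)
  rw [← sub_nonneg]
  convert add_nonneg h1 h2 using 1
  simp only [realPart_apply_coe, star_sub, star_smul, star_one, mul_sub, sub_mul, smul_mul_assoc,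
    mul_smul_comm, one_mul, mul_one, star_trivial]
  module

theorem isUnit_of_isStrictlyPositive_realPart {a : E} (h : IsStrictlyPositive (ℜ a : E)) :
    IsUnit a := by
  obtain ⟨ε, hε, hle⟩ := h.exists_smul_one_le
  have h1 := (isStrictlyPositive_of_smul_one_le (by positivity)
    (smul_one_le_star_mul_self hε.le hle)).isUnit
  have h2 := (isStrictlyPositive_of_smul_one_le (by positivity)
    (smul_one_le_star_mul_self (a := star a) hε.le (by rwa [realPart_star_coe]))).isUnit
  rw [star_star] at h2
  obtain ⟨b, hb⟩ := h2.exists_right_inv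
  obtain ⟨c, hc⟩ := h1.exists_left_inv
  exact isUnit_iff_exists_and_exists.2
    ⟨⟨star a * b, by rw [← mul_assoc, hb]⟩, ⟨c * star a, by rw [mul_assoc, hc]⟩⟩

theorem norm_ringInverse_le {a : E} {ε : ℝ} (hε : 0 < ε) (h : ε • (1 : E) ≤ ℜ a) :
    ‖a⁻¹ʳ‖ ≤ ε⁻¹ := by
  have hu := isUnit_of_isStrictlyPositive_realPart (isStrictlyPositive_of_smul_one_le hε h)
  have h1 := star_left_conjugate_le_conjugate (smul_one_le_star_mul_self hε.le h) a⁻¹ʳ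
  have h2 : star a⁻¹ʳ * (star a * a) * a⁻¹ʳ = 1 := by
    rw [mul_assoc, mul_assoc, Ring.mul_inverse_cancel _ hu, mul_one, ← star_mul,
      Ring.mul_inverse_cancel _ hu, star_one]
  have h3 : star a⁻¹ʳ * a⁻¹ʳ ≤ algebraMap ℝ E ((ε⁻¹) ^ 2) := by
    rw [h2, mul_smul_comm, smul_mul_assoc, mul_one] at h1
    have := smul_le_smul_of_nonneg_left h1 (by positivity : 0 ≤ (ε⁻¹) ^ 2)
    rw [smul_smul, ← mul_pow, inv_mul_cancel₀ hε.ne', one_pow, one_smul] at this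
    rwa [Algebra.algebraMap_eq_smul_one]
  rw [← CStarAlgebra.norm_le_iff_le_algebraMap _ (by positivity) (star_mul_self_nonneg _),
    CStarRing.norm_star_mul_self, ← sq] at h3
  exact (sq_le_sq₀ (norm_nonneg _) (by positivity)).1 h3

end Accretive

/-! ### The norm of a product of positive elements. -/

section NormMul

variable {E : Type*} [CStarAlgebra E] [PartialOrder E] [StarOrderedRing E]

theorem IsSelfAdjoint.norm_le_of_spectrum {E : Type*} [CStarAlgebra E] {a : E} (ha : IsSelfAdjoint a) {r : ℝ} (hr : 0 ≤ r)
    (h : ∀ μ : ℝ, r < |μ| → IsUnit (algebraMap ℝ E μ - a)) : ‖a‖ ≤ r := by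
  obtain _ | _ := subsingleton_or_nontrivial E
  · rwa [Subsingleton.elim a 0, norm_zero]
  by_contra! hlt
  rcases CStarAlgebra.norm_or_neg_norm_mem_spectrum ha with hm | hm
  · exact hm (h _ (by rwa [abs_norm]))
  · exact hm (h _ (by rwa [abs_neg, abs_norm]))

theorem isUnit_algebraMap_sub_of_abs_realPart_le {a : E} {r μ : ℝ} (h₁ : -(r • (1 : E)) ≤ ℜ a)
    (h₂ : (ℜ a : E) ≤ r • (1 : E)) (hμ : r < |μ|) : IsUnit (algebraMap ℝ E μ - a) := by
  have hre : (ℜ (algebraMap ℝ E μ - a) : E) = μ • 1 - ℜ a := by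
    rw [map_sub, AddSubgroupClass.coe_sub, realPart_apply_coe (algebraMap ℝ E μ),
      Algebra.algebraMap_eq_smul_one]
    simp only [star_smul, star_one, star_trivial]
    module
  rcases le_or_gt 0 μ with h0 | h0
  · rw [abs_of_nonneg h0] at hμ
    refine isUnit_of_isStrictlyPositive_realPart
      (isStrictlyPositive_of_smul_one_le (sub_pos.2 hμ) ?_)
    rw [hre, sub_smul]
    exact sub_le_sub_left h₂ _
  · rw [abs_of_neg h0] at hμ
    rw [← IsUnit.neg_iff]
    refine isUnit_of_isStrictlyPositive_realPart
      (isStrictlyPositive_of_smul_one_le (sub_pos.2 hμ) ?_)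
    rw [map_neg, NegMemClass.coe_neg, hre, sub_smul, neg_sub, neg_smul, sub_eq_add_neg,
      sub_eq_add_neg, add_comm]
    exact add_le_add_left h₁ _

/-- `DZD` is self-adjoint, so its norm is read off its spectrum, which away from 0 is that of `D²Z`.
The real part of `D²Z` is `(P - Q)/4`, between `-1/4` and `1/4`; for real `μ` with `|μ| > 1/4`, one
of `±(μ - D²Z)` then has strictly positive real part and is invertible. -/
theorem norm_mul_mul_le_one_div_four {D Z P Q : E} (hW : IsSelfAdjoint (D * Z * D))
    (hP₀ : 0 ≤ P) (hP₁ : P ≤ 1) (hQ₀ : 0 ≤ Q) (hQ₁ : Q ≤ 1)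
    (h : (D * (D * Z) + star (D * (D * Z))) + (D * (D * Z) + star (D * (D * Z))) = P - Q) :
    ‖D * Z * D‖ ≤ 1 / 4 := by
  have hre : (ℜ (D * (D * Z)) : E) = (1 / 4 : ℝ) • (P - Q) := by
    rw [realPart_apply_coe, ← h]
    module
  refine hW.norm_le_of_spectrum (by norm_num) fun μ hμ => ?_
  have hμ0 : μ ≠ 0 := by
    rintro rfl
    norm_num at hμ
  have hu : IsUnit (algebraMap ℝ _ μ - D * (D * Z)) := by
    refine isUnit_algebraMap_sub_of_abs_realPart_le (r := 1 / 4) ?_ ?_ hμ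
    · rw [hre, ← smul_neg]
      refine smul_le_smul_of_nonneg_left ?_ (by norm_num)
      rw [neg_le_sub_iff_le_add]
      exact hQ₁.trans (le_add_of_nonneg_left hP₀)
    · rw [hre]
      refine smul_le_smul_of_nonneg_left ?_ (by norm_num)
      exact sub_le_self_iff _ |>.2 hQ₀ |>.trans hP₁
  by_contra hn
  have : μ ∈ spectrum ℝ (D * Z * D) \ {0} := ⟨hn, hμ0⟩
  rw [← spectrum.nonzero_mul_comm] at this
  exact this.1 hu

/-- The arithmetic-geometric mean inequality of Bhatia and Kittaneh for the norm of a product. -/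
theorem norm_mul_le_one_div_four {X Y : E} (hX : 0 ≤ X) (hY : 0 ≤ Y) (hXY : X + Y ≤ 1) :
    ‖X * Y‖ ≤ 1 / 4 := by
  obtain ⟨x, hx, rfl⟩ : ∃ x : E, IsSelfAdjoint x ∧ x * x = X :=
    ⟨CFC.sqrt X, (CFC.sqrt_nonneg X).isSelfAdjoint, CFC.sqrt_mul_sqrt_self X⟩
  obtain ⟨y, hy, rfl⟩ : ∃ y : E, IsSelfAdjoint y ∧ y * y = Y :=
    ⟨CFC.sqrt Y, (CFC.sqrt_nonneg Y).isSelfAdjoint, CFC.sqrt_mul_sqrt_self Y⟩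
  obtain ⟨c, hc, hcc⟩ : ∃ c : E, IsSelfAdjoint c ∧ c * c = 1 - (x * x + y * y) :=
    ⟨CFC.sqrt _, (CFC.sqrt_nonneg _).isSelfAdjoint,
      CFC.sqrt_mul_sqrt_self _ (sub_nonneg.2 hXY)⟩
  let mk : E → E → E → E → CStarMatrix (Fin 2) (Fin 2) E :=
    fun a b c d => CStarMatrix.ofMatrix !![a, b; c, d]
  have mk_star : ∀ a b c d, star (mk a b c d) = mk (star a) (star c) (star b) (star d) := by
    intro a b c d
    ext i j
    fin_cases i <;> fin_cases j <;> simp [mk, CStarMatrix.star_apply]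
  have mk_mul : ∀ a b c d a' b' c' d', mk a b c d * mk a' b' c' d' =
      mk (a * a' + b * c') (a * b' + b * d') (c * a' + d * c') (c * b' + d * d') := by
    intro a b c d a' b' c' d'
    ext i j
    fin_cases i <;> fin_cases j <;> simp [mk, CStarMatrix.mul_apply, Fin.sum_univ_two]
  have mk_sub : ∀ a b c d a' b' c' d', mk a b c d - mk a' b' c' d' =
      mk (a - a') (b - b') (c - c') (d - d') := by
    intro a b c d a' b' c' d'
    ext i j
    fin_cases i <;> fin_cases j <;> simp [mk]
  have mk_add : ∀ a b c d a' b' c' d', mk a b c d + mk a' b' c' d' =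
      mk (a + a') (b + b') (c + c') (d + d') := by
    intro a b c d a' b' c' d'
    ext i j
    fin_cases i <;> fin_cases j <;> simp [mk]
  have mk_one : mk 1 0 0 1 = 1 := by
    ext i j
    fin_cases i <;> fin_cases j <;> simp [mk]
  -- `T*T = diag(x² + y², 0)`, so `S = TT*` is a contraction. Conjugation by `J` flips the
  -- off-diagonal signs, so `S² - JS²J` is twice the off-diagonal part of `S²`, with entry `x³y +
  -- xy³`; this part is `D²Z + (D²Z)*`. The corner of `DZD` is `x²y² = XY`.
  set T := mk x 0 y 0 with hT
  set D := mk x 0 0 y with hD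
  set Z := mk 0 (x * y) (y * x) 0 with hZ
  set J := mk 1 0 0 (-1) with hJ
  have hTT : star T * T ≤ 1 := by
    have : 1 - star T * T = star (mk c 0 0 1) * mk c 0 0 1 := by
      simp [hT, mk_star, mk_mul, ← mk_one, mk_sub, hx.star_eq, hy.star_eq, hc.star_eq, hcc]
    rw [← sub_nonneg, this]
    exact star_mul_self_nonneg _
  have hS : ‖T * star T‖ ≤ 1 := by
    rw [← CStarAlgebra.norm_le_one_iff_of_nonneg _ (star_mul_self_nonneg _),
      CStarRing.norm_star_mul_self, ← CStarRing.norm_self_mul_star] at hTT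
    exact hTT
  have hS2 : ∀ U : CStarMatrix (Fin 2) (Fin 2) E, ‖U‖ ≤ 1 → star U * U ≤ 1 := by
    intro U hU
    rw [← CStarAlgebra.norm_le_one_iff_of_nonneg _ (star_mul_self_nonneg _),
      CStarRing.norm_star_mul_self]
    exact mul_le_one₀ hU (norm_nonneg _) hU
  have h1 := hS2 _ hS
  have hJJ : star J * J = 1 := by simp [hJ, mk_star, mk_mul, mk_one]
  have h2 : star (T * star T * J) * (T * star T * J) ≤ 1 := by
    have := star_left_conjugate_le_conjugate h1 J
    rw [mul_one, hJJ] at this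
    simpa [mul_assoc] using this
  have h1' := star_mul_self_nonneg (T * star T)
  have h2' := star_mul_self_nonneg (T * star T * J)
  have hre : (D * (D * Z) + star (D * (D * Z))) + (D * (D * Z) + star (D * (D * Z))) =
      star (T * star T) * (T * star T) - star (T * star T * J) * (T * star T * J) := by
    simp only [hT, hD, hZ, hJ, mk_star, mk_mul, mk_sub, mk_add, star_mul, hx.star_eq,
      hy.star_eq, star_zero, star_neg, mul_zero, zero_mul, add_zero, zero_add,
      mul_one, mul_neg, neg_mul]
    congr 1 <;> simp only [mul_assoc] <;> abel
  have hW : IsSelfAdjoint (D * Z * D) := by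
    rw [IsSelfAdjoint]
    simp [hD, hZ, mk_star, mk_mul, hx.star_eq, hy.star_eq, mul_assoc]
  have hnorm := norm_mul_mul_le_one_div_four hW h1' h1 h2' h2 hre
  refine le_trans ?_ hnorm
  have := CStarMatrix.norm_entry_le_norm (M := D * Z * D) (i := 0) (j := 1)
  simpa [hD, hZ, mk_mul, mk, mul_assoc] using this

end NormMul

/-! ### Inverses, real parts and resolvent estimates. -/

section RingInverse

open Ring

theorem ringInverse_smul {E : Type*} [Ring E] [Algebra ℝ E] {r : ℝ} (hr : r ≠ 0) {a : E}
    (ha : IsUnit a) : (r • a)⁻¹ʳ = r⁻¹ • a⁻¹ʳ := by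
  have h := Ring.inverse_mul (a := r • (1 : E)) (b := a) (Or.inr ha)
  rwa [ringInverse_smul_one hr, smul_one_mul, mul_smul_comm, mul_one] at h

variable {E : Type*} [CStarAlgebra E] [PartialOrder E] [StarOrderedRing E]

/-- If `a P + b Q⁻¹ ≤ c`, then `P² ≤ (c² / (4ab))² Q²`. -/
theorem sq_le_smul_sq_of_smul_add_smul_inverse_le {P Q : E} (hP : 0 ≤ P)
    (hQ : IsStrictlyPositive Q) {a b c : ℝ} (ha : 0 < a) (hb : 0 < b) (hc : 0 < c)
    (h : a • P + b • Q⁻¹ʳ ≤ c • (1 : E)) :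
    P ^ 2 ≤ ((c ^ 2 / (4 * (a * b))) ^ 2) • Q ^ 2 := by
  have h1 : (a / c) • P + (b / c) • Q⁻¹ʳ ≤ 1 := by
    have := smul_le_smul_of_nonneg_left h (inv_nonneg.2 hc.le)
    rwa [smul_add, smul_smul, smul_smul, smul_smul, inv_mul_cancel₀ hc.ne', one_smul,
      inv_mul_eq_div, inv_mul_eq_div] at this
  have h2 := norm_mul_le_one_div_four (smul_nonneg (by positivity) hP)
    (smul_nonneg (by positivity : 0 ≤ b / c) hQ.ringInverse.nonneg) h1
  rw [smul_mul_smul_comm, norm_smul, Real.norm_of_nonneg (by positivity)] at h2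
  have h3 : ‖P * Q⁻¹ʳ‖ ≤ c ^ 2 / (4 * (a * b)) := by
    rw [le_div_iff₀ (by positivity)]
    rw [div_mul_div_comm, div_mul_eq_mul_div, div_le_iff₀ (by positivity)] at h2
    linarith
  have h4 : star (P * Q⁻¹ʳ) * (P * Q⁻¹ʳ) ≤ ((c ^ 2 / (4 * (a * b))) ^ 2) • (1 : E) := by
    rw [← Algebra.algebraMap_eq_smul_one, ← CStarAlgebra.norm_le_iff_le_algebraMap _
      (by positivity) (star_mul_self_nonneg _), CStarRing.norm_star_mul_self, ← sq]
    exact pow_le_pow_left₀ (norm_nonneg _) h3 2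
  have h5 := star_left_conjugate_le_conjugate h4 Q
  rw [mul_smul_comm, mul_one, smul_mul_assoc, hQ.isSelfAdjoint.star_eq, ← sq] at h5
  convert h5 using 1
  rw [star_mul, hQ.ringInverse.isSelfAdjoint.star_eq, hP.isSelfAdjoint.star_eq, mul_assoc,
    mul_assoc, mul_assoc, mul_assoc, Ring.mul_inverse_cancel_left _ _ hQ.isUnit,
    Ring.inverse_mul_cancel _ hQ.isUnit, mul_one, sq]

theorem star_mul_realPart_mul {E : Type*} [CStarAlgebra E] (U X : E) :
    star U * (ℜ X : E) * U = (2⁻¹ : ℝ) • (star U * (X * U) + star (star U * (X * U))) := by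
  simp only [realPart_apply_coe, mul_smul_comm, smul_mul_assoc, mul_add, add_mul, star_mul,
    star_star, mul_assoc]

theorem realPart_ringInverse_eq {E : Type*} [CStarAlgebra E] {X : E} (hX : IsUnit X) :
    (ℜ X⁻¹ʳ : E) = star X⁻¹ʳ * (ℜ X : E) * X⁻¹ʳ := by
  rw [star_mul_realPart_mul, Ring.mul_inverse_cancel _ hX, mul_one, star_star, realPart_apply_coe,
    add_comm]

theorem isStrictlyPositive_realPart_ringInverse {X : E} (hX : IsStrictlyPositive (ℜ X : E)) :
    IsStrictlyPositive (ℜ X⁻¹ʳ : E) := by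
  have hu := isUnit_of_isStrictlyPositive_realPart hX
  rw [realPart_ringInverse_eq hu, hu.ringInverse.isStrictlyPositive_star_left_conjugate_iff]
  exact hX

/-- Completing the square with respect to a strictly positive `H`. -/
theorem smul_sub_le_star_mul_mul {H L U : E} (hH : IsStrictlyPositive H) (hL : IsSelfAdjoint L)
    (r : ℝ) : r • (L * U + star U * L) - (r ^ 2) • (L * H⁻¹ʳ * L) ≤ star U * H * U := by
  have h := star_left_conjugate_nonneg hH.nonneg (U - r • (H⁻¹ʳ * L))
  rw [← sub_nonneg]
  convert h using 1
  have e1 : ∀ x, H⁻¹ʳ * (H * x) = x := fun x => Ring.inverse_mul_cancel_left _ _ hH.isUnit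
  have e2 : ∀ x, H * (H⁻¹ʳ * x) = x := fun x => Ring.mul_inverse_cancel_left _ _ hH.isUnit
  simp only [star_sub, star_smul, star_mul, hH.ringInverse.isSelfAdjoint.star_eq, hL.star_eq,
    star_trivial, sub_mul, mul_sub, smul_mul_assoc, mul_smul_comm, mul_assoc, e1, e2]
  module

theorem realPart_ringInverse_le {X : E} (hX : IsStrictlyPositive (ℜ X : E)) :
    (ℜ X⁻¹ʳ : E) ≤ (ℜ X : E)⁻¹ʳ := by
  have h := smul_sub_le_star_mul_mul (U := X⁻¹ʳ) hX (IsSelfAdjoint.one E) 1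
  rw [← realPart_ringInverse_eq (isUnit_of_isStrictlyPositive_realPart hX)] at h
  simp only [one_mul, mul_one, one_smul, one_pow] at h
  have h2 : X⁻¹ʳ + star X⁻¹ʳ = (ℜ X⁻¹ʳ : E) + ℜ X⁻¹ʳ := by
    rw [realPart_apply_coe]
    module
  rw [h2, sub_le_iff_le_add, add_le_add_iff_left] at h
  exact h

theorem realPart_add_smul {E : Type*} [CStarAlgebra E] (A B : E) (s : ℝ) : (ℜ (A + s • B) : E) = ℜ A + s • (ℜ B : E) := by
  simp only [realPart_apply_coe, star_add, star_smul, star_trivial]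
  module

theorem isStrictlyPositive_add_smul {A B : E} (hA : IsStrictlyPositive A)
    (hB : IsStrictlyPositive B) {s : ℝ} (hs : 0 ≤ s) : IsStrictlyPositive (A + s • B) :=
  hA.add_nonneg (smul_nonneg hs hB.nonneg)

theorem isStrictlyPositive_convexCombo {A B : E} (hA : IsStrictlyPositive A)
    (hB : IsStrictlyPositive B) {v : ℝ} (hv₀ : 0 ≤ v) (hv₁ : v ≤ 1) :
    IsStrictlyPositive ((1 - v) • A + v • B) :=
  CStarAlgebra.convexOn_ringInverse.1 hA hB (sub_nonneg.2 hv₁) hv₀ (by ring)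

theorem realPart_resolvent_le {A B : E} (hA : IsStrictlyPositive (ℜ A : E))
    (hB : IsStrictlyPositive (ℜ B : E)) {s : ℝ} (hs : 0 < s) :
    (ℜ (A + s • B)⁻¹ʳ : E) ≤
      ((1 + s) ^ 2)⁻¹ • ((ℜ A : E)⁻¹ʳ + s • (ℜ B : E)⁻¹ʳ) := by
  have h1 : IsStrictlyPositive (ℜ (A + s • B) : E) := by
    rw [realPart_add_smul]
    exact isStrictlyPositive_add_smul hA hB hs.le
  refine (realPart_ringInverse_le h1).trans ?_
  have hs' : 0 < 1 + s := by positivity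
  have h2 := CStarAlgebra.convexOn_ringInverse.2 hA hB
    (by positivity : 0 ≤ (1 + s)⁻¹) (by positivity : 0 ≤ s / (1 + s)) (by field_simp)
  have h3 : (ℜ (A + s • B) : E) =
      (1 + s) • ((1 + s)⁻¹ • (ℜ A : E) + (s / (1 + s)) • (ℜ B : E)) := by
    rw [realPart_add_smul, smul_add, smul_smul, smul_smul, mul_inv_cancel₀ hs'.ne', one_smul,
      mul_div_cancel₀ _ hs'.ne']
  have h4 := CStarAlgebra.convexOn_ringInverse.1 hA hB
    (by positivity : 0 ≤ (1 + s)⁻¹) (by positivity : 0 ≤ s / (1 + s)) (by field_simp)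
  rw [h3, ringInverse_smul hs'.ne' h4.isUnit]
  refine (smul_le_smul_of_nonneg_left h2 (by positivity)).trans_eq ?_
  rw [smul_add, smul_add, smul_smul, smul_smul, smul_smul]
  congr 2 <;> field_simp

/-- With `C` the resolvent, `U = A⁻¹C` and `V = B⁻¹C` satisfy `U + sV = 1` and `ℜC = U*(ℜA)U +
sV*(ℜB)V`. Completing the square in both terms with the same `r = 1/(1 + s)` makes the linear parts
add up to `2rL`. The free `L` is chosen only after integration. -/
theorem le_realPart_resolvent {A B : E} (hA : IsStrictlyPositive (ℜ A : E))
    (hB : IsStrictlyPositive (ℜ B : E)) {L : E} (hL : IsSelfAdjoint L) {s : ℝ} (hs : 0 < s) :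
    (2 * (1 + s)⁻¹) • L - ((1 + s) ^ 2)⁻¹ • (L * (ℜ A : E)⁻¹ʳ * L + s • (L * (ℜ B : E)⁻¹ʳ * L)) ≤
      ℜ (A⁻¹ʳ + s • B⁻¹ʳ)⁻¹ʳ := by
  have huA := isUnit_of_isStrictlyPositive_realPart hA
  have huB := isUnit_of_isStrictlyPositive_realPart hB
  have hu : IsUnit (A⁻¹ʳ + s • B⁻¹ʳ) := by
    refine isUnit_of_isStrictlyPositive_realPart ?_
    rw [realPart_add_smul]
    exact isStrictlyPositive_add_smul (isStrictlyPositive_realPart_ringInverse hA)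
      (isStrictlyPositive_realPart_ringInverse hB) hs.le
  set C := (A⁻¹ʳ + s • B⁻¹ʳ)⁻¹ʳ with hC
  have hUV : A⁻¹ʳ * C + s • (B⁻¹ʳ * C) = 1 := by
    rw [← Ring.mul_inverse_cancel _ hu, add_mul, smul_mul_assoc]
  have h1 := smul_sub_le_star_mul_mul (U := A⁻¹ʳ * C) hA hL (1 + s)⁻¹
  have h2 := smul_le_smul_of_nonneg_left
    (smul_sub_le_star_mul_mul (U := B⁻¹ʳ * C) hB hL (1 + s)⁻¹) hs.le
  have h3 := add_le_add h1 h2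
  rw [star_mul_realPart_mul, star_mul_realPart_mul, Ring.mul_inverse_cancel_left _ _ huA,
    Ring.mul_inverse_cancel_left _ _ huB] at h3
  generalize A⁻¹ʳ * C = U at *
  generalize B⁻¹ʳ * C = V at *
  obtain rfl : U = 1 - s • V := eq_sub_of_add_eq hUV
  have hs' : 1 + s ≠ 0 := by positivity
  convert h3 using 1
  · simp only [star_sub, star_one, star_smul, star_trivial, mul_sub, sub_mul, mul_one, one_mul,
      mul_smul_comm, smul_mul_assoc, ← inv_pow]
    module
  · rw [realPart_apply_coe]
    simp only [star_sub, star_one, star_smul, star_trivial, sub_mul, one_mul,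
      smul_mul_assoc, star_mul, star_star]
    module

end RingInverse

/-! ### Beta integrals for the scalar weights. -/

section Beta

open MeasureTheory Set

theorem integrableOn_and_integral_beta {a b : ℝ} (ha : 0 < a) (hb : 0 < b) :
    IntegrableOn (fun x : ℝ => x ^ (a - 1) * (1 - x) ^ (b - 1)) (Ioo 0 1) ∧
      ∫ x in Ioo (0 : ℝ) 1, x ^ (a - 1) * (1 - x) ^ (b - 1) =
        Real.Gamma a * Real.Gamma b / Real.Gamma (a + b) := by
  have hc := Complex.betaIntegral_convergent (u := a) (v := b) (by simpa) (by simpa)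
  rw [intervalIntegrable_iff_integrableOn_Ioo_of_le zero_le_one] at hc
  have heq : EqOn (fun x : ℝ => (x : ℂ) ^ ((a : ℂ) - 1) * (1 - (x : ℂ)) ^ ((b : ℂ) - 1))
      (fun x : ℝ => ((x ^ (a - 1) * (1 - x) ^ (b - 1) : ℝ) : ℂ)) (Ioo 0 1) := by
    intro x hx
    simp only
    rw [Complex.ofReal_mul, Complex.ofReal_cpow hx.1.le, Complex.ofReal_cpow (sub_pos.2 hx.2).le]
    push_cast
    rfl
  have hc2 := hc.congr_fun heq measurableSet_Ioo
  refine ⟨by simpa [IntegrableOn] using hc2.re, ?_⟩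
  have h := ProbabilityTheory.beta_eq_betaIntegralReal a b ha hb
  rw [ProbabilityTheory.beta] at h
  rw [h, Complex.betaIntegral, intervalIntegral.integral_of_le zero_le_one,
    integral_Ioc_eq_integral_Ioo, setIntegral_congr_fun measurableSet_Ioo heq,
    integral_complex_ofReal, Complex.ofReal_re]

theorem image_div_one_add_Ioi : (fun s : ℝ => s / (1 + s)) '' Ioi 0 = Ioo 0 1 := by
  ext t
  constructor
  · rintro ⟨s, hs, rfl⟩
    have hs' : 0 < s := hs
    exact ⟨by positivity, by rw [div_lt_one (by positivity)]; linarith⟩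
  · rintro ⟨h0, h1⟩
    have h2 : 0 < 1 - t := sub_pos.2 h1
    refine ⟨t / (1 - t), div_pos h0 h2, ?_⟩
    field_simp
    ring

/-- The substitution `x = s / (1 + s)` turns the Beta integral on `(0, 1)` into one on the
half-line. -/
theorem integrableOn_and_integral_rpow_mul_one_add_rpow {a b : ℝ} (ha : 0 < a) (hb : 0 < b) :
    IntegrableOn (fun s : ℝ => s ^ (a - 1) * (1 + s) ^ (-(a + b))) (Ioi 0) ∧
      ∫ s in Ioi (0 : ℝ), s ^ (a - 1) * (1 + s) ^ (-(a + b)) =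
        Real.Gamma a * Real.Gamma b / Real.Gamma (a + b) := by
  obtain ⟨h1, h2⟩ := integrableOn_and_integral_beta ha hb
  have hder : ∀ s ∈ Ioi (0 : ℝ),
      HasDerivWithinAt (fun s : ℝ => s / (1 + s)) (((1 + s) ^ 2)⁻¹) (Ioi 0) s := by
    intro s hs
    have hs' : 0 < s := hs
    have h := (hasDerivAt_id s).div ((hasDerivAt_id s).const_add 1) (by simp; positivity)
    refine (h.congr_deriv ?_).hasDerivWithinAt
    simp
  have hinj : InjOn (fun s : ℝ => s / (1 + s)) (Ioi 0) := by
    intro s hs t ht hst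
    have hs' : 0 < s := hs
    have ht' : 0 < t := ht
    simp only at hst
    rw [div_eq_div_iff (by positivity) (by positivity)] at hst
    linarith
  have heq : EqOn (fun s : ℝ => |((1 + s) ^ 2)⁻¹| •
      ((s / (1 + s)) ^ (a - 1) * (1 - s / (1 + s)) ^ (b - 1)))
      (fun s : ℝ => s ^ (a - 1) * (1 + s) ^ (-(a + b))) (Ioi 0) := by
    intro s hs
    have hs' : 0 < s := hs
    have h1s : 0 < 1 + s := by positivity
    have e1 : 1 - s / (1 + s) = (1 + s)⁻¹ := by field_simp; ring
    have e2 : ((1 + s) ^ 2)⁻¹ = (1 + s) ^ (-2 : ℝ) := by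
      rw [Real.rpow_neg h1s.le]; norm_num
    simp only [smul_eq_mul]
    rw [abs_of_nonneg (by positivity), e1, e2, Real.div_rpow hs'.le h1s.le,
      Real.inv_rpow h1s.le, div_eq_mul_inv, ← Real.rpow_neg h1s.le, ← Real.rpow_neg h1s.le,
      mul_assoc, ← Real.rpow_add h1s, mul_left_comm, ← Real.rpow_add h1s]
    ring_nf
  rw [← image_div_one_add_Ioi] at h1 h2
  rw [integrableOn_image_iff_integrableOn_abs_deriv_smul measurableSet_Ioi hder hinj] at h1
  rw [integral_image_eq_integral_abs_deriv_smul measurableSet_Ioi hder hinj,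
    setIntegral_congr_fun measurableSet_Ioi heq] at h2
  exact ⟨h1.congr_fun heq measurableSet_Ioi, h2⟩

theorem integrableOn_and_integral_rpow_mul_inv_one_add {v : ℝ} (hv₀ : 0 < v) (hv₁ : v < 1) :
    IntegrableOn (fun s : ℝ => s ^ (v - 1) * (1 + s)⁻¹) (Ioi 0) ∧
      ∫ s in Ioi (0 : ℝ), s ^ (v - 1) * (1 + s)⁻¹ = Real.pi / Real.sin (v * Real.pi) := by
  have h := integrableOn_and_integral_rpow_mul_one_add_rpow hv₀ (sub_pos.2 hv₁)
  rw [Real.Gamma_mul_Gamma_one_sub, add_sub_cancel, Real.Gamma_one, div_one, mul_comm Real.pi] at h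
  simpa only [Real.rpow_neg_one] using h

theorem integrableOn_and_integral_rpow_mul_inv_one_add_sq {v : ℝ} (hv₀ : 0 < v) (hv₁ : v < 1) :
    IntegrableOn (fun s : ℝ => s ^ (v - 1) * ((1 + s) ^ 2)⁻¹) (Ioi 0) ∧
      ∫ s in Ioi (0 : ℝ), s ^ (v - 1) * ((1 + s) ^ 2)⁻¹ =
        (1 - v) * (Real.pi / Real.sin (v * Real.pi)) := by
  have h := integrableOn_and_integral_rpow_mul_one_add_rpow hv₀ (by linarith : 0 < (1 - v) + 1)
  rw [Real.Gamma_add_one (by linarith), mul_left_comm, Real.Gamma_mul_Gamma_one_sub,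
    show v + (1 - v + 1) = 2 by ring, Real.Gamma_two, div_one, mul_comm Real.pi] at h
  have heq : EqOn (fun s : ℝ => s ^ (v - 1) * (1 + s) ^ (-2 : ℝ))
      (fun s : ℝ => s ^ (v - 1) * ((1 + s) ^ 2)⁻¹) (Ioi 0) := by
    intro s hs
    have hs' : 0 < s := hs
    simp only
    rw [Real.rpow_neg (by positivity)]
    norm_num
  exact ⟨h.1.congr_fun heq measurableSet_Ioi,
    (setIntegral_congr_fun measurableSet_Ioi heq).symm.trans h.2⟩

theorem integrableOn_and_integral_rpow_mul_mul_inv_one_add_sq {v : ℝ} (hv₀ : 0 < v)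
    (hv₁ : v < 1) :
    IntegrableOn (fun s : ℝ => s ^ (v - 1) * (((1 + s) ^ 2)⁻¹ * s)) (Ioi 0) ∧
      ∫ s in Ioi (0 : ℝ), s ^ (v - 1) * (((1 + s) ^ 2)⁻¹ * s) =
        v * (Real.pi / Real.sin (v * Real.pi)) := by
  obtain ⟨h1, h2⟩ := integrableOn_and_integral_rpow_mul_inv_one_add hv₀ hv₁
  obtain ⟨h3, h4⟩ := integrableOn_and_integral_rpow_mul_inv_one_add_sq hv₀ hv₁
  have heq : EqOn (fun s : ℝ => s ^ (v - 1) * (1 + s)⁻¹ - s ^ (v - 1) * ((1 + s) ^ 2)⁻¹)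
      (fun s : ℝ => s ^ (v - 1) * (((1 + s) ^ 2)⁻¹ * s)) (Ioi 0) := by
    intro s hs
    have hs' : 0 < s := hs
    simp only
    field_simp
    ring
  refine ⟨(h1.sub h3).congr_fun heq measurableSet_Ioi, ?_⟩
  rw [← setIntegral_congr_fun measurableSet_Ioi heq, integral_sub h1 h3, h2, h4]
  ring

end Beta

/-! ### Integrated bounds for the geometric mean. -/

section Integral

open Ring MeasureTheory Set

theorem realPart_integral {E X : Type*} [CStarAlgebra E] [MeasurableSpace X] {μ : Measure X}
    {f : X → E} (hf : Integrable f μ) : (ℜ (∫ x, f x ∂μ) : E) = ∫ x, (ℜ (f x) : E) ∂μ := by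
  have hs : star (∫ x, f x ∂μ) = ∫ x, star (f x) ∂μ :=
    ((starL' ℝ : E ≃L[ℝ] E).integral_comp_comm f).symm
  have hi : Integrable (fun x => star (f x)) μ := (starL' ℝ : E ≃L[ℝ] E).integrable_comp_iff.2 hf
  simp only [realPart_apply_coe]
  rw [integral_smul, integral_add hf hi, hs]

theorem integrable_realPart {E X : Type*} [CStarAlgebra E] [MeasurableSpace X] {μ : Measure X}
    {f : X → E} (hf : Integrable f μ) : Integrable (fun x => (ℜ (f x) : E)) μ := by
  have hi : Integrable (fun x => star (f x)) μ := (starL' ℝ : E ≃L[ℝ] E).integrable_comp_iff.2 hf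
  simp only [realPart_apply_coe]
  exact (hf.add hi).smul _

theorem realPart_real_smul {E : Type*} [CStarAlgebra E] (r : ℝ) (a : E) :
    (ℜ (r • a) : E) = r • (ℜ a : E) := by
  simp only [realPart_apply_coe, star_smul, star_trivial]
  module

variable {E : Type*} [CStarAlgebra E] [PartialOrder E] [StarOrderedRing E]

theorem integrableOn_rpow_smul_resolvent {A B : E} (hA : IsStrictlyPositive (ℜ A : E))
    (hB : IsStrictlyPositive (ℜ B : E)) {v : ℝ} (hv₀ : 0 < v) (hv₁ : v < 1) :
    IntegrableOn (fun s : ℝ => s ^ (v - 1) • (A + s • B)⁻¹ʳ) (Ioi 0) := by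
  obtain ⟨a, ha, hA'⟩ := hA.exists_smul_one_le
  obtain ⟨b, hb, hB'⟩ := hB.exists_smul_one_le
  set c := min a b
  have hc : 0 < c := lt_min ha hb
  have hle : ∀ s : ℝ, 0 < s → (c * (1 + s)) • (1 : E) ≤ ℜ (A + s • B) := by
    intro s hs
    rw [realPart_add_smul, mul_add, mul_one, add_smul, mul_comm c s, mul_smul]
    refine add_le_add (le_trans ?_ hA') (smul_le_smul_of_nonneg_left (le_trans ?_ hB') hs.le)
    · exact smul_le_smul_of_nonneg_right (min_le_left _ _) zero_le_one
    · exact smul_le_smul_of_nonneg_right (min_le_right _ _) zero_le_one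
  have hpos : ∀ s : ℝ, 0 < s → 0 < c * (1 + s) := fun s hs => by positivity
  have hcont : ContinuousOn (fun s : ℝ => s ^ (v - 1) • (A + s • B)⁻¹ʳ) (Ioi 0) := by
    intro s hs
    have hu := isUnit_of_isStrictlyPositive_realPart
      (isStrictlyPositive_of_smul_one_le (hpos s hs) (hle s hs))
    refine ContinuousAt.continuousWithinAt (ContinuousAt.fun_smul (M := ℝ) ?_ ?_)
    · exact Real.continuousAt_rpow_const _ _ (Or.inl (ne_of_gt hs))
    · have h1 := NormedRing.inverse_continuousAt hu.unit
      exact ContinuousAt.comp (f := fun s : ℝ => A + s • B) h1 (by fun_prop)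
  -- As `ℜ(A + sB) ≥ c(1 + s)`, the resolvent has norm at most `1 / (c(1 + s))`.
  refine Integrable.mono' ((integrableOn_and_integral_rpow_mul_inv_one_add hv₀ hv₁).1.const_mul c⁻¹)
    (hcont.aestronglyMeasurable measurableSet_Ioi) ?_
  filter_upwards [ae_restrict_mem measurableSet_Ioi] with s hs
  have hs' : 0 < s := hs
  rw [norm_smul, Real.norm_of_nonneg (by positivity)]
  calc s ^ (v - 1) * ‖(A + s • B)⁻¹ʳ‖ ≤ s ^ (v - 1) * (c * (1 + s))⁻¹ := by
        gcongr
        exact norm_ringInverse_le (hpos s hs) (hle s hs)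
    _ = c⁻¹ * (s ^ (v - 1) * (1 + s)⁻¹) := by
        rw [mul_inv]
        ring

theorem sin_mul_pi_pos {v : ℝ} (hv₀ : 0 < v) (hv₁ : v < 1) : 0 < Real.sin (v * Real.pi) :=
  Real.sin_pos_of_pos_of_lt_pi (by positivity) (by nlinarith [Real.pi_pos])

theorem realPart_integral_resolvent_le {A B : E} (hA : IsStrictlyPositive (ℜ A : E))
    (hB : IsStrictlyPositive (ℜ B : E)) {v : ℝ} (hv₀ : 0 < v) (hv₁ : v < 1) :
    (ℜ ((Real.sin (v * Real.pi) / Real.pi) •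
        ∫ s in Ioi (0 : ℝ), s ^ (v - 1) • (A + s • B)⁻¹ʳ) : E) ≤
      (1 - v) • (ℜ A : E)⁻¹ʳ + v • (ℜ B : E)⁻¹ʳ := by
  have hi := integrableOn_rpow_smul_resolvent hA hB hv₀ hv₁
  have hsin := sin_mul_pi_pos hv₀ hv₁
  obtain ⟨h1, h2⟩ := integrableOn_and_integral_rpow_mul_inv_one_add_sq hv₀ hv₁
  obtain ⟨h3, h4⟩ := integrableOn_and_integral_rpow_mul_mul_inv_one_add_sq hv₀ hv₁
  have h5 : (∫ s in Ioi (0 : ℝ), (ℜ (s ^ (v - 1) • (A + s • B)⁻¹ʳ) : E)) ≤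
      ∫ s in Ioi (0 : ℝ), ((s ^ (v - 1) * ((1 + s) ^ 2)⁻¹) • (ℜ A : E)⁻¹ʳ +
        (s ^ (v - 1) * (((1 + s) ^ 2)⁻¹ * s)) • (ℜ B : E)⁻¹ʳ) := by
    refine integral_mono_ae (integrable_realPart hi)
      ((h1.smul_const _).add (h3.smul_const _)) ?_
    filter_upwards [ae_restrict_mem measurableSet_Ioi] with s hs
    have hs' : 0 < s := hs
    rw [realPart_real_smul]
    refine (smul_le_smul_of_nonneg_left (realPart_resolvent_le hA hB hs)
      (by positivity)).trans_eq ?_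
    module
  rw [realPart_real_smul, realPart_integral hi]
  refine (smul_le_smul_of_nonneg_left h5 (by positivity)).trans_eq ?_
  rw [integral_add (h1.smul_const _) (h3.smul_const _), integral_smul_const, integral_smul_const,
    h2, h4, smul_add, smul_smul, smul_smul]
  congr 2 <;> field_simp

theorem le_realPart_integral_resolvent {A B : E} (hA : IsStrictlyPositive (ℜ A : E))
    (hB : IsStrictlyPositive (ℜ B : E)) {v : ℝ} (hv₀ : 0 < v) (hv₁ : v < 1) :
    ((1 - v) • (ℜ A : E)⁻¹ʳ + v • (ℜ B : E)⁻¹ʳ)⁻¹ʳ ≤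
      ℜ ((Real.sin (v * Real.pi) / Real.pi) •
        ∫ s in Ioi (0 : ℝ), s ^ (v - 1) • (A⁻¹ʳ + s • B⁻¹ʳ)⁻¹ʳ) := by
  have hi := integrableOn_rpow_smul_resolvent (isStrictlyPositive_realPart_ringInverse hA)
    (isStrictlyPositive_realPart_ringInverse hB) hv₀ hv₁
  have hsin := sin_mul_pi_pos hv₀ hv₁
  have hN := isStrictlyPositive_convexCombo hA.ringInverse hB.ringInverse hv₀.le hv₁.le
  set N := (1 - v) • (ℜ A : E)⁻¹ʳ + v • (ℜ B : E)⁻¹ʳ with hNdef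
  -- Integration of the pointwise bound gives `2L - LNL`, which equals `L` for this choice.
  set L := N⁻¹ʳ with hL
  have hLN : L * N * L = L := by rw [Ring.inverse_mul_cancel _ hN.isUnit, one_mul]
  obtain ⟨h1, h2⟩ := integrableOn_and_integral_rpow_mul_inv_one_add_sq hv₀ hv₁
  obtain ⟨h3, h4⟩ := integrableOn_and_integral_rpow_mul_mul_inv_one_add_sq hv₀ hv₁
  obtain ⟨h6, h7⟩ := integrableOn_and_integral_rpow_mul_inv_one_add hv₀ hv₁
  have h5 : (∫ s in Ioi (0 : ℝ), ((s ^ (v - 1) * (1 + s)⁻¹) • ((2 : ℝ) • L) -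
        ((s ^ (v - 1) * ((1 + s) ^ 2)⁻¹) • (L * (ℜ A : E)⁻¹ʳ * L) +
        (s ^ (v - 1) * (((1 + s) ^ 2)⁻¹ * s)) • (L * (ℜ B : E)⁻¹ʳ * L)))) ≤
      ∫ s in Ioi (0 : ℝ), (ℜ (s ^ (v - 1) • (A⁻¹ʳ + s • B⁻¹ʳ)⁻¹ʳ) : E) := by
    refine integral_mono_ae ((h6.smul_const _).sub ((h1.smul_const _).add (h3.smul_const _)))
      (integrable_realPart hi) ?_
    filter_upwards [ae_restrict_mem measurableSet_Ioi] with s hs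
    have hs' : 0 < s := hs
    rw [realPart_real_smul]
    refine le_of_eq_of_le ?_ (smul_le_smul_of_nonneg_left
      (le_realPart_resolvent hA hB hN.ringInverse.isSelfAdjoint hs) (by positivity))
    module
  rw [realPart_real_smul, realPart_integral hi]
  refine le_of_eq_of_le ?_ (smul_le_smul_of_nonneg_left h5 (by positivity))
  rw [integral_sub (h6.smul_const _) ((h1.smul_const _).add (h3.smul_const _)),
    integral_add (h1.smul_const _) (h3.smul_const _), integral_smul_const, integral_smul_const,
    integral_smul_const, h2, h4, h7]
  have hk : Real.sin (v * Real.pi) / Real.pi * (Real.pi / Real.sin (v * Real.pi)) = 1 := by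
    field_simp
  have : L = (2 : ℝ) • L - ((1 - v) • (L * (ℜ A : E)⁻¹ʳ * L) + v • (L * (ℜ B : E)⁻¹ʳ * L)) := by
    have : (1 - v) • (L * (ℜ A : E)⁻¹ʳ * L) + v • (L * (ℜ B : E)⁻¹ʳ * L) = L * N * L := by
      simp only [hNdef, mul_add, add_mul, mul_smul_comm, smul_mul_assoc]
    rw [this, hLN]
    module
  conv_lhs => rw [this]
  rw [smul_sub, smul_add, smul_smul, smul_smul, smul_smul, smul_smul, hk, one_mul, mul_left_comm,
    hk, mul_one, mul_left_comm, hk, mul_one]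

end Integral

/-! ### Sectorial elements and the secant constant. -/

section Sectorial

open Ring

theorem imaginaryPart_ringInverse_eq {E : Type*} [CStarAlgebra E] {X : E} (hX : IsUnit X) :
    (ℑ X⁻¹ʳ : E) = -(star X⁻¹ʳ * (ℑ X : E) * X⁻¹ʳ) := by
  have h1 : star X⁻¹ʳ * star X = 1 := by rw [← star_mul, Ring.mul_inverse_cancel _ hX, star_one]
  simp only [imaginaryPart_apply_coe, mul_smul_comm, smul_mul_assoc, mul_sub, sub_mul, mul_assoc,
    Ring.mul_inverse_cancel _ hX, mul_one]
  rw [← mul_assoc, h1, one_mul, ← smul_neg, ← smul_neg, neg_sub]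

variable {E : Type*} [CStarAlgebra E] [PartialOrder E] [StarOrderedRing E]

/-- `X` is sectorial with tangent `t`: its real part is strictly positive and dominates its
imaginary part up to the factor `t`. -/
structure IsSectorial (t : ℝ) (X : E) : Prop where
  realPart_pos : IsStrictlyPositive (ℜ X : E)
  add_nonneg : 0 ≤ t • (ℜ X : E) + (ℑ X : E)
  sub_nonneg : 0 ≤ t • (ℜ X : E) - (ℑ X : E)

theorem IsSectorial.ringInverse {t : ℝ} {X : E} (hX : IsSectorial t X) : IsSectorial t X⁻¹ʳ := by
  have hu := isUnit_of_isStrictlyPositive_realPart hX.realPart_pos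
  refine ⟨isStrictlyPositive_realPart_ringInverse hX.realPart_pos, ?_, ?_⟩
  · convert star_left_conjugate_nonneg hX.sub_nonneg X⁻¹ʳ using 1
    rw [realPart_ringInverse_eq hu, imaginaryPart_ringInverse_eq hu, mul_sub, sub_mul,
      mul_smul_comm, smul_mul_assoc, sub_eq_add_neg]
  · convert star_left_conjugate_nonneg hX.add_nonneg X⁻¹ʳ using 1
    rw [realPart_ringInverse_eq hu, imaginaryPart_ringInverse_eq hu, mul_add, add_mul,
      mul_smul_comm, smul_mul_assoc, sub_neg_eq_add]

theorem imaginaryPart_real_smul {E : Type*} [CStarAlgebra E] (r : ℝ) (a : E) :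
    (ℑ (r • a) : E) = r • (ℑ a : E) := by
  simp only [imaginaryPart_apply_coe, star_smul, star_trivial, ← smul_sub, smul_comm r]

theorem IsSectorial.convexCombo {t : ℝ} {X Y : E} (hX : IsSectorial t X) (hY : IsSectorial t Y)
    {v : ℝ} (hv₀ : 0 ≤ v) (hv₁ : v ≤ 1) : IsSectorial t ((1 - v) • X + v • Y) := by
  have hre : (ℜ ((1 - v) • X + v • Y) : E) = (1 - v) • (ℜ X : E) + v • (ℜ Y : E) := by
    rw [realPart_add_smul, realPart_real_smul]
  have him : (ℑ ((1 - v) • X + v • Y) : E) = (1 - v) • (ℑ X : E) + v • (ℑ Y : E) := by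
    rw [map_add, AddSubgroup.coe_add, imaginaryPart_real_smul, imaginaryPart_real_smul]
  refine ⟨?_, ?_, ?_⟩
  · rw [hre]
    exact isStrictlyPositive_convexCombo hX.realPart_pos hY.realPart_pos hv₀ hv₁
  · convert _root_.add_nonneg (smul_nonneg (_root_.sub_nonneg.2 hv₁) hX.add_nonneg)
      (smul_nonneg hv₀ hY.add_nonneg) using 1
    rw [hre, him]
    module
  · convert _root_.add_nonneg (smul_nonneg (_root_.sub_nonneg.2 hv₁) hX.sub_nonneg)
      (smul_nonneg hv₀ hY.sub_nonneg) using 1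
    rw [hre, him]
    module

theorem mul_ringInverse_mul_le {H K : E} {t : ℝ} (ht : 0 ≤ t) (hH : IsStrictlyPositive H)
    (h₁ : 0 ≤ t • H + K) (h₂ : 0 ≤ t • H - K) : K * H⁻¹ʳ * K ≤ (t ^ 2) • H := by
  rcases ht.eq_or_lt with rfl | ht
  · rw [zero_smul, zero_add] at h₁
    rw [zero_smul, zero_sub, neg_nonneg] at h₂
    simp [le_antisymm h₂ h₁]
  have hG := hH.ringInverse.isSelfAdjoint.star_eq

  have e2 : ∀ x, H * (H⁻¹ʳ * x) = x := fun x => Ring.mul_inverse_cancel_left _ _ hH.isUnit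
  have e3 : H⁻¹ʳ * H = 1 := Ring.inverse_mul_cancel _ hH.isUnit
  -- With `G = H⁻¹`, the sum `(tH - K)G(tH + K)G(tH - K) + (tH + K)G(tH - K)G(tH + K)` equals
  -- `2t(t²H - KGK)`; dividing by `2t` is why `t = 0` was split off.
  have h3 := star_left_conjugate_nonneg h₁ (H⁻¹ʳ * (t • H - K))
  have h4 := star_left_conjugate_nonneg h₂ (H⁻¹ʳ * (t • H + K))
  have h5 := smul_nonneg (by positivity : 0 ≤ (2 * t)⁻¹) (add_nonneg h3 h4)
  rw [← sub_nonneg]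
  convert h5 using 1
  have hK : star K = K := by
    have hs : IsSelfAdjoint K := by
      simpa using h₁.isSelfAdjoint.sub (IsSelfAdjoint.smul (IsSelfAdjoint.all t) hH.isSelfAdjoint)
    exact hs.star_eq
  simp only [star_mul, star_sub, star_add, star_smul, star_trivial, star_one, hK,
    hG, mul_add, add_mul, mul_sub, sub_mul, smul_mul_assoc, mul_smul_comm, mul_assoc, e2,
    e3, mul_one, one_mul]
  rw [eq_inv_smul_iff₀ (by positivity)]
  module

/-- For `X = H + iK`, the left side is `XH⁻¹X* = H + KH⁻¹K`, and sectoriality bounds the second term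
by `t²H`. -/
theorem IsSectorial.ringInverse_realPart_ringInverse_le {t : ℝ} (ht : 0 ≤ t) {X : E}
    (hX : IsSectorial t X) : (ℜ X⁻¹ʳ : E)⁻¹ʳ ≤ (1 + t ^ 2) • (ℜ X : E) := by
  have hu := isUnit_of_isStrictlyPositive_realPart hX.realPart_pos
  have hH := hX.realPart_pos
  have h := mul_ringInverse_mul_le ht hX.realPart_pos hX.add_nonneg hX.sub_nonneg
  rw [add_smul, one_smul]
  refine le_of_eq_of_le ?_ (add_le_add_right h _)
  rw [realPart_ringInverse_eq hu, Ring.inverse_mul (Or.inr hu.ringInverse),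
    Ring.inverse_mul (Or.inr hH.isUnit), Ring.inverse_inverse hu, ← Ring.inverse_star,
    Ring.inverse_inverse hu.star]
  set H : E := (ℜ X : E) with hHdef
  set K : E := (ℑ X : E) with hKdef
  have hX' : X = H + Complex.I • K := (realPart_add_I_smul_imaginaryPart X).symm
  have hHs : star H = H := (ℜ X).2.star_eq
  have hKs : star K = K := (ℑ X).2.star_eq
  have e2 : ∀ x, H * (H⁻¹ʳ * x) = x := fun x => Ring.mul_inverse_cancel_left _ _ hH.isUnit
  have e3 : H⁻¹ʳ * H = 1 := Ring.inverse_mul_cancel _ hH.isUnit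
  clear_value H K
  subst hX'
  simp only [star_add, star_smul, hHs, hKs, mul_add, add_mul, smul_mul_assoc, mul_smul_comm,
    mul_assoc, e2, e3, mul_one, smul_add, smul_smul, Complex.star_def, Complex.conj_I,
    mul_neg, Complex.I_mul_I, one_smul, neg_smul]
  abel

/-- The Kantorovich-type bound `T + m M T⁻¹ ≤ m + M`. -/
theorem add_smul_ringInverse_le {T : E} {m M : ℝ} (hm : 0 < m) (h₁ : m • (1 : E) ≤ T)
    (h₂ : T ≤ M • (1 : E)) : T + (m * M) • T⁻¹ʳ ≤ (m + M) • (1 : E) := by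
  have hT := isStrictlyPositive_of_smul_one_le hm h₁
  have c0 : Commute T T⁻¹ʳ := by
    rw [commute_iff_eq, Ring.mul_inverse_cancel _ hT.isUnit, Ring.inverse_mul_cancel _ hT.isUnit]
  have c1 : Commute (T - m • 1) (M • 1 - T) := by
    refine Commute.sub_left ?_ ?_
    · exact ((Commute.one_right T).smul_right M).sub_right (Commute.refl T)
    · exact (Commute.one_left _).smul_left m
  have c2 : Commute T⁻¹ʳ ((T - m • 1) * (M • 1 - T)) := by
    refine Commute.mul_right ?_ ?_
    · exact c0.symm.sub_right ((Commute.one_right _).smul_right m)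
    · exact ((Commute.one_right _).smul_right M).sub_right c0.symm
  -- `T⁻¹(T - m)(M - T) = (m + M) - T - mM T⁻¹` is a product of commuting positive factors.
  have h := Commute.mul_nonneg hT.ringInverse.nonneg
    (Commute.mul_nonneg (sub_nonneg.2 h₁) (sub_nonneg.2 h₂) c1) c2
  rw [← sub_nonneg]
  convert h using 1
  have e1 : ∀ x, T⁻¹ʳ * (T * x) = x := fun x => Ring.inverse_mul_cancel_left _ _ hT.isUnit
  have e3 : T⁻¹ʳ * T = 1 := Ring.inverse_mul_cancel _ hT.isUnit
  simp only [mul_sub, sub_mul, smul_mul_assoc, mul_smul_comm, mul_one, one_mul, e1, e3]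
  module

end Sectorial

/-! ### From numerical ranges and matrix means to the abstract bounds. -/

section MatrixMeans

open Ring MeasureTheory Set Matrix
open scoped Matrix.Norms.L2Operator ComplexOrder

variable {n : ℕ}

theorem star_dotProduct_mulVec_mem_sector {A : Matrix (Fin n) (Fin n) ℂ} {α : ℝ}
    (hA : numericalRange A ⊆ sector α) {x : Fin n → ℂ} (hx : x ≠ 0) :
    star x ⬝ᵥ A *ᵥ x ∈ sector α := by
  obtain ⟨r, hr, hrx⟩ : ∃ r : ℝ, 0 < r ∧ star x ⬝ᵥ x = r := by
    have h := dotProduct_star_self_pos_iff.2 hx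
    obtain ⟨h1, h2⟩ := Complex.pos_iff.1 h
    exact ⟨_, h1, Complex.ext (Complex.ofReal_re _).symm (by simpa using h2.symm)⟩
  set c : ℝ := (√r)⁻¹ with hc
  have hcr : c * c = r⁻¹ := by
    rw [hc, ← mul_inv, Real.mul_self_sqrt hr.le]
  have h1 : ∀ B : Matrix (Fin n) (Fin n) ℂ,
      star ((c : ℂ) • x) ⬝ᵥ B *ᵥ ((c : ℂ) • x) = ((r⁻¹ : ℝ) : ℂ) * (star x ⬝ᵥ B *ᵥ x) := by
    intro B
    rw [star_smul, mulVec_smul, smul_dotProduct, dotProduct_smul, smul_smul, ← hcr]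
    simp
  have h2 : ((r⁻¹ : ℝ) : ℂ) * (star x ⬝ᵥ A *ᵥ x) ∈ sector α := by
    refine hA ⟨(c : ℂ) • x, ?_, h1 A⟩
    have := h1 1
    rw [one_mulVec, one_mulVec, hrx, ← Complex.ofReal_mul, inv_mul_cancel₀ hr.ne'] at this
    simpa using this
  obtain ⟨h3, h4⟩ := h2
  rw [Complex.re_ofReal_mul] at h3 h4
  rw [Complex.im_ofReal_mul, abs_mul, abs_of_pos (inv_pos.2 hr), mul_assoc] at h4
  exact ⟨(mul_pos_iff_of_pos_left (inv_pos.2 hr)).1 h3,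
    le_of_mul_le_mul_left h4 (inv_pos.2 hr)⟩

theorem star_dotProduct_star_mulVec (A : Matrix (Fin n) (Fin n) ℂ) (x : Fin n → ℂ) :
    star x ⬝ᵥ (star A) *ᵥ x = star (star x ⬝ᵥ A *ᵥ x) := by
  rw [← star_dotProduct, star_mulVec, ← dotProduct_mulVec, star_eq_conjTranspose]

theorem star_dotProduct_realPart_mulVec (A : Matrix (Fin n) (Fin n) ℂ) (x : Fin n → ℂ) :
    star x ⬝ᵥ (ℜ A : Matrix (Fin n) (Fin n) ℂ) *ᵥ x = ((star x ⬝ᵥ A *ᵥ x).re : ℂ) := by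
  rw [realPart_apply_coe, smul_mulVec, add_mulVec, dotProduct_smul, dotProduct_add,
    star_dotProduct_star_mulVec]
  apply Complex.ext <;> simp; ring

theorem star_dotProduct_imaginaryPart_mulVec (A : Matrix (Fin n) (Fin n) ℂ) (x : Fin n → ℂ) :
    star x ⬝ᵥ (ℑ A : Matrix (Fin n) (Fin n) ℂ) *ᵥ x = ((star x ⬝ᵥ A *ᵥ x).im : ℂ) := by
  rw [imaginaryPart_apply_coe, smul_mulVec, smul_mulVec, sub_mulVec, dotProduct_smul,
    dotProduct_smul, dotProduct_sub, star_dotProduct_star_mulVec]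
  apply Complex.ext <;> simp; ring

theorem isSectorial_of_numericalRange_subset_sector {A : Matrix (Fin n) (Fin n) ℂ} {α : ℝ}
    (hA : numericalRange A ⊆ sector α) : IsSectorial (Real.tan α) A := by
  have hre : IsSelfAdjoint (ℜ A : Matrix (Fin n) (Fin n) ℂ) := (ℜ A).2
  have him : IsSelfAdjoint (ℑ A : Matrix (Fin n) (Fin n) ℂ) := (ℑ A).2
  have hsm := IsSelfAdjoint.smul (IsSelfAdjoint.all (Real.tan α)) hre
  refine ⟨isStrictlyPositive_iff_posDef.2 (.of_dotProduct_mulVec_pos hre fun x hx => ?_),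
    nonneg_iff_posSemidef.2 (.of_dotProduct_mulVec_nonneg (hsm.add him) fun x => ?_),
    nonneg_iff_posSemidef.2 (.of_dotProduct_mulVec_nonneg (hsm.sub him) fun x => ?_)⟩
  · rw [star_dotProduct_realPart_mulVec]
    exact_mod_cast (star_dotProduct_mulVec_mem_sector hA hx).1
  · rcases eq_or_ne x 0 with rfl | hx
    · simp
    have h := (star_dotProduct_mulVec_mem_sector hA hx).2
    rw [add_mulVec, dotProduct_add, smul_mulVec, dotProduct_smul, star_dotProduct_realPart_mulVec,
      star_dotProduct_imaginaryPart_mulVec, Complex.real_smul]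
    norm_cast
    linarith [abs_le.1 h]
  · rcases eq_or_ne x 0 with rfl | hx
    · simp
    have h := (star_dotProduct_mulVec_mem_sector hA hx).2
    rw [sub_mulVec, dotProduct_sub, smul_mulVec, dotProduct_smul, star_dotProduct_realPart_mulVec,
      star_dotProduct_imaginaryPart_mulVec, Complex.real_smul]
    norm_cast
    linarith [abs_le.1 h]

/-- Entries are continuous linear functionals, so the entrywise integral agrees with the Bochner
integral. -/
theorem geomMean_eq_smul_integral {A B : Matrix (Fin n) (Fin n) ℂ}
    (hA : IsStrictlyPositive (ℜ A : Matrix (Fin n) (Fin n) ℂ))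
    (hB : IsStrictlyPositive (ℜ B : Matrix (Fin n) (Fin n) ℂ)) {v : ℝ} (hv₀ : 0 < v)
    (hv₁ : v < 1) :
    geomMean v A B = (Real.sin (v * Real.pi) / Real.pi) •
      ∫ s in Ioi (0 : ℝ), s ^ (v - 1) • (A⁻¹ʳ + s • B⁻¹ʳ)⁻¹ʳ := by
  have hi := integrableOn_rpow_smul_resolvent (isStrictlyPositive_realPart_ringInverse hA)
    (isStrictlyPositive_realPart_ringInverse hB) hv₀ hv₁
  rw [geomMean, if_neg hv₀.ne', if_neg hv₁.ne]
  congr 1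
  ext i j
  rw [of_apply]
  have h := (LinearMap.toContinuousLinearMap
    (entryLinearMap ℂ ℂ i j : Matrix (Fin n) (Fin n) ℂ →ₗ[ℂ] ℂ)).integral_comp_comm hi
  simp only [LinearMap.coe_toContinuousLinearMap', entryLinearMap_apply] at h
  simp only [nonsing_inv_eq_ringInverse]
  exact h

theorem le_realPart_geomMean {A B : Matrix (Fin n) (Fin n) ℂ}
    (hA : IsStrictlyPositive (ℜ A : Matrix (Fin n) (Fin n) ℂ))
    (hB : IsStrictlyPositive (ℜ B : Matrix (Fin n) (Fin n) ℂ)) {v : ℝ} (hv₀ : 0 ≤ v)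
    (hv₁ : v ≤ 1) :
    ((1 - v) • (ℜ A : Matrix (Fin n) (Fin n) ℂ)⁻¹ʳ +
      v • (ℜ B : Matrix (Fin n) (Fin n) ℂ)⁻¹ʳ)⁻¹ʳ ≤ ℜ (geomMean v A B) := by
  rcases hv₀.eq_or_lt with rfl | hv₀
  · simp [geomMean, Ring.inverse_inverse hA.isUnit]
  rcases hv₁.eq_or_lt with rfl | hv₁
  · simp [geomMean, Ring.inverse_inverse hB.isUnit]
  rw [geomMean_eq_smul_integral hA hB hv₀ hv₁]
  exact le_realPart_integral_resolvent hA hB hv₀ hv₁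

theorem realPart_geomMean_le {A B : Matrix (Fin n) (Fin n) ℂ}
    (hA : IsStrictlyPositive (ℜ A : Matrix (Fin n) (Fin n) ℂ))
    (hB : IsStrictlyPositive (ℜ B : Matrix (Fin n) (Fin n) ℂ)) {v : ℝ} (hv₀ : 0 ≤ v)
    (hv₁ : v ≤ 1) :
    (ℜ (geomMean v A B) : Matrix (Fin n) (Fin n) ℂ) ≤
      (1 - v) • (ℜ A⁻¹ʳ : Matrix (Fin n) (Fin n) ℂ)⁻¹ʳ +
        v • (ℜ B⁻¹ʳ : Matrix (Fin n) (Fin n) ℂ)⁻¹ʳ := by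
  have key : ∀ {X : Matrix (Fin n) (Fin n) ℂ},
      IsStrictlyPositive (ℜ X : Matrix (Fin n) (Fin n) ℂ) →
      (ℜ X : Matrix (Fin n) (Fin n) ℂ) ≤ (ℜ X⁻¹ʳ : Matrix (Fin n) (Fin n) ℂ)⁻¹ʳ := by
    intro X hX
    have h := realPart_ringInverse_le (isStrictlyPositive_realPart_ringInverse hX)
    rwa [Ring.inverse_inverse (isUnit_of_isStrictlyPositive_realPart hX)] at h
  rcases hv₀.eq_or_lt with rfl | hv₀
  · simpa [geomMean] using key hA
  rcases hv₁.eq_or_lt with rfl | hv₁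
  · simpa [geomMean] using key hB
  rw [geomMean_eq_smul_integral hA hB hv₀ hv₁]
  exact realPart_integral_resolvent_le (isStrictlyPositive_realPart_ringInverse hA)
    (isStrictlyPositive_realPart_ringInverse hB) hv₀ hv₁

end MatrixMeans

/-! ### Choi's inequality by spectral resolution. -/

section PositiveMap

open Ring Matrix
open scoped Matrix.Norms.L2Operator ComplexOrder

variable {n : ℕ} {𝒜 : Type*} [CStarAlgebra 𝒜] [PartialOrder 𝒜] [StarOrderedRing 𝒜]

/-- A strictly positive matrix is a combination of a resolution of the identity, and so is its
inverse. -/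
theorem exists_spectral_resolution {T : Matrix (Fin n) (Fin n) ℂ} (hT : IsStrictlyPositive T) :
    ∃ (t : Fin n → ℝ) (e : Fin n → Matrix (Fin n) (Fin n) ℂ), (∀ i, 0 < t i) ∧ (∀ i, 0 ≤ e i) ∧
      ∑ i, e i = 1 ∧ ∑ i, (t i : ℂ) • e i = T ∧ ∑ i, ((t i)⁻¹ : ℂ) • e i = T⁻¹ʳ := by
  have hpd := isStrictlyPositive_iff_posDef.1 hT
  set φ := Unitary.conjStarAlgAut ℂ (Matrix (Fin n) (Fin n) ℂ) hpd.1.eigenvectorUnitary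
  have hdiag : ∀ f : Fin n → ℂ, ∑ i, f i • φ (single i i 1) = φ (diagonal f) := by
    intro f
    simp_rw [← map_smul, ← map_sum, smul_single, smul_eq_mul, mul_one, sum_single_eq_diagonal]
  have hTφ : φ (diagonal fun i => (hpd.1.eigenvalues i : ℂ)) = T := hpd.1.spectral_theorem.symm
  refine ⟨hpd.1.eigenvalues, fun i => φ (single i i 1), hpd.eigenvalues_pos, fun i => ?_, ?_, ?_,
    ?_⟩
  · have h : (single i i 1 : Matrix (Fin n) (Fin n) ℂ) = star (single i i 1) * single i i 1 := by
      simp [star_eq_conjTranspose]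
    beta_reduce
    rw [h, map_mul, map_star]
    exact star_mul_self_nonneg _
  · have h := hdiag 1
    simpa using h
  · rw [hdiag, hTφ]
  · rw [hdiag, ← nonsing_inv_eq_ringInverse]
    refine (inv_eq_left_inv ?_).symm
    refine (congrArg (φ _ * ·) hTφ).symm.trans ?_
    rw [← map_mul, diagonal_mul_diagonal]
    have : (fun i => ((hpd.1.eigenvalues i : ℂ))⁻¹ * (hpd.1.eigenvalues i : ℂ)) = 1 := by
      ext i
      exact inv_mul_cancel₀ (by exact_mod_cast (hpd.eigenvalues_pos i).ne')
    rw [this]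
    simp

theorem map_real_smul_matrix {𝒜 : Type*} [CStarAlgebra 𝒜] [PartialOrder 𝒜]
    (Φ : Matrix (Fin n) (Fin n) ℂ →ₚ[ℂ] 𝒜) (r : ℝ) (X : Matrix (Fin n) (Fin n) ℂ) :
    Φ (r • X) = r • Φ X := by
  rw [← Complex.coe_smul, map_smul, Complex.coe_smul]

variable (Φ : Matrix (Fin n) (Fin n) ℂ →ₚ[ℂ] 𝒜)

theorem map_isStrictlyPositive (hΦ : Φ 1 = 1) {T : Matrix (Fin n) (Fin n) ℂ}
    (hT : IsStrictlyPositive T) : IsStrictlyPositive (Φ T) := by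
  obtain ⟨ε, hε, h⟩ := hT.exists_smul_one_le
  have := OrderHomClass.mono Φ h
  rw [map_real_smul_matrix, hΦ] at this
  exact isStrictlyPositive_of_smul_one_le hε this

/-- Choi's inequality for positive unital linear maps. -/
theorem ringInverse_map_le_map_ringInverse (hΦ : Φ 1 = 1) {T : Matrix (Fin n) (Fin n) ℂ}
    (hT : IsStrictlyPositive T) : (Φ T)⁻¹ʳ ≤ Φ T⁻¹ʳ := by
  have hQ := map_isStrictlyPositive Φ hΦ hT
  obtain ⟨t, e, ht, he, h1, h2, h3⟩ := exists_spectral_resolution hT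
  set Y := (Φ T)⁻¹ʳ with hY
  have hYs : star Y = Y := hQ.ringInverse.isSelfAdjoint.star_eq
  -- This sum expands to `Φ(T⁻¹) - 2Y + YΦ(T)Y = Φ(T⁻¹) - Y`.
  have hnonneg : 0 ≤ ∑ i, (t i)⁻¹ • (star (1 - t i • Y) * Φ (e i) * (1 - t i • Y)) := by
    refine Finset.sum_nonneg fun i _ => smul_nonneg (inv_nonneg.2 (ht i).le) ?_
    exact star_left_conjugate_nonneg (map_nonneg Φ (he i)) _
  have hterm : ∀ i, (t i)⁻¹ • (star (1 - t i • Y) * Φ (e i) * (1 - t i • Y)) =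
      (t i)⁻¹ • Φ (e i) - Φ (e i) * Y - Y * Φ (e i) + Y * (t i • Φ (e i)) * Y := by
    intro i
    have hti := (ht i).ne'
    simp only [star_sub, star_one, star_smul, star_trivial, hYs, sub_mul, mul_sub, one_mul, mul_one,
      smul_mul_assoc, mul_smul_comm, smul_sub, smul_smul, inv_mul_cancel₀ hti, one_smul]
    rw [← mul_assoc (t i)⁻¹, inv_mul_cancel₀ hti, one_mul]
    abel
  have e1 : ∑ i, Φ (e i) = 1 := by rw [← map_sum, h1, hΦ]
  have e2 : ∑ i, t i • Φ (e i) = Φ T := by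
    rw [← h2, map_sum]
    exact Finset.sum_congr rfl fun i _ => by rw [map_smul, Complex.coe_smul]
  have e3 : ∑ i, (t i)⁻¹ • Φ (e i) = Φ T⁻¹ʳ := by
    rw [← h3, map_sum]
    exact Finset.sum_congr rfl fun i _ => by rw [map_smul, ← Complex.ofReal_inv, Complex.coe_smul]
  simp only [hterm, Finset.sum_add_distrib, Finset.sum_sub_distrib, ← Finset.sum_mul,
    ← Finset.mul_sum] at hnonneg
  rw [e1, e2, e3, one_mul, mul_one, hY, Ring.inverse_mul_cancel _ hQ.isUnit, one_mul,
    sub_add_cancel] at hnonneg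
  exact sub_nonneg.1 hnonneg

end PositiveMap

/-! ### The two inequalities with their sharper constants. -/

section Main

open Ring Matrix
open scoped Matrix.Norms.L2Operator ComplexOrder

variable {n : ℕ} {𝒜 : Type*} [CStarAlgebra 𝒜] [PartialOrder 𝒜] [StarOrderedRing 𝒜]
  (Φ : Matrix (Fin n) (Fin n) ℂ →ₚ[ℂ] 𝒜) {A B : Matrix (Fin n) (Fin n) ℂ} {v m M : ℝ}

theorem map_realPart_arithMean_sq_le (hΦ : Φ 1 = 1)
    (hv₀ : 0 ≤ v) (hv₁ : v ≤ 1) (hm : 0 < m) (hmM : m ≤ M)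
    (hA₁ : m • (1 : Matrix (Fin n) (Fin n) ℂ) ≤ ℜ A)
    (hA₂ : ℜ A ≤ M • (1 : Matrix (Fin n) (Fin n) ℂ))
    (hB₁ : m • (1 : Matrix (Fin n) (Fin n) ℂ) ≤ ℜ B)
    (hB₂ : ℜ B ≤ M • (1 : Matrix (Fin n) (Fin n) ℂ)) :
    Φ (ℜ (arithMean v A B)) ^ 2 ≤ (kantorovich (M / m) ^ 2) • Φ (ℜ (geomMean v A B)) ^ 2 := by
  have hM : 0 < M := hm.trans_le hmM
  have hA := isStrictlyPositive_of_smul_one_le hm hA₁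
  have hB := isStrictlyPositive_of_smul_one_le hm hB₁
  have hN := isStrictlyPositive_convexCombo hA.ringInverse hB.ringInverse hv₀ hv₁
  have hG := le_realPart_geomMean hA hB hv₀ hv₁
  have hGpos := hN.ringInverse.of_le hG
  have hGinv := CStarAlgebra.ringInverse_le_ringInverse hG hN.ringInverse
  rw [Ring.inverse_inverse hN.isUnit] at hGinv
  have hre : (ℜ (arithMean v A B) : Matrix (Fin n) (Fin n) ℂ) =
      (1 - v) • (ℜ A : Matrix (Fin n) (Fin n) ℂ) + v • (ℜ B : Matrix (Fin n) (Fin n) ℂ) := by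
    rw [arithMean, realPart_add_smul, realPart_real_smul]
  have hpos : 0 ≤ (ℜ (arithMean v A B) : Matrix (Fin n) (Fin n) ℂ) := by
    rw [hre]
    exact (isStrictlyPositive_convexCombo hA hB hv₀ hv₁).nonneg
  have key : (ℜ (arithMean v A B) : Matrix (Fin n) (Fin n) ℂ) +
      (m * M) • (ℜ (geomMean v A B) : Matrix (Fin n) (Fin n) ℂ)⁻¹ʳ ≤ (m + M) • 1 := by
    have hA' := smul_le_smul_of_nonneg_left (add_smul_ringInverse_le hm hA₁ hA₂)
      (sub_nonneg.2 hv₁)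
    have hB' := smul_le_smul_of_nonneg_left (add_smul_ringInverse_le hm hB₁ hB₂) hv₀
    refine (add_le_add_right (smul_le_smul_of_nonneg_left hGinv (by positivity)) _).trans ?_
    rw [hre]
    refine le_of_eq_of_le ?_ ((add_le_add hA' hB').trans_eq ?_) <;> module
  have hΦkey := OrderHomClass.mono Φ key
  rw [map_add, map_real_smul_matrix, map_real_smul_matrix, hΦ] at hΦkey
  have hQ := map_isStrictlyPositive Φ hΦ hGpos
  have hchoi := ringInverse_map_le_map_ringInverse Φ hΦ hGpos
  -- Here `c² / (4ab) = (m + M)² / (4mM)`, which is `K(M/m)`.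
  have h := sq_le_smul_sq_of_smul_add_smul_inverse_le (map_nonneg Φ hpos) hQ one_pos
    (mul_pos hm hM) (add_pos hm hM) (by
      rw [one_smul]
      exact (add_le_add_right (smul_le_smul_of_nonneg_left hchoi (by positivity)) _).trans hΦkey)
  convert h using 3
  rw [kantorovich]
  field_simp
  ring

theorem map_realPart_geomMean_sq_le (hΦ : Φ 1 = 1) {t : ℝ} (ht : 0 ≤ t) (hA : IsSectorial t A)
    (hB : IsSectorial t B) (hv₀ : 0 ≤ v) (hv₁ : v ≤ 1) (hm : 0 < m) (hmM : m ≤ M)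
    (hA₁ : m • (1 : Matrix (Fin n) (Fin n) ℂ) ≤ ℜ A⁻¹ʳ)
    (hA₂ : ℜ A⁻¹ʳ ≤ M • (1 : Matrix (Fin n) (Fin n) ℂ))
    (hB₁ : m • (1 : Matrix (Fin n) (Fin n) ℂ) ≤ ℜ B⁻¹ʳ)
    (hB₂ : ℜ B⁻¹ʳ ≤ M • (1 : Matrix (Fin n) (Fin n) ℂ)) :
    Φ (ℜ (geomMean v A B)) ^ 2 ≤
      (((1 + t ^ 2) * kantorovich (M / m)) ^ 2) • Φ (ℜ (harmMean v A B)) ^ 2 := by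
  have hM : 0 < M := hm.trans_le hmM
  have ht' : 0 < 1 + t ^ 2 := by positivity
  have hN := hA.ringInverse.convexCombo hB.ringInverse hv₀ hv₁
  have hharm : harmMean v A B = ((1 - v) • A⁻¹ʳ + v • B⁻¹ʳ)⁻¹ʳ := by
    rw [harmMean]
    simp only [nonsing_inv_eq_ringInverse]
  have hT := hN.ringInverse.realPart_pos
  have hTinv := hN.ringInverse_realPart_ringInverse_le ht
  rw [← hharm] at hT hTinv
  rw [realPart_add_smul, realPart_real_smul] at hTinv
  have hP := realPart_geomMean_le hA.realPart_pos hB.realPart_pos hv₀ hv₁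
  have hpos : 0 ≤ (ℜ (geomMean v A B) : Matrix (Fin n) (Fin n) ℂ) :=
    (isStrictlyPositive_convexCombo hA.realPart_pos.ringInverse
      hB.realPart_pos.ringInverse hv₀ hv₁).ringInverse.nonneg.trans
      (le_realPart_geomMean hA.realPart_pos hB.realPart_pos hv₀ hv₁)
  have key : (m * M) • (ℜ (geomMean v A B) : Matrix (Fin n) (Fin n) ℂ) +
      (1 + t ^ 2)⁻¹ • (ℜ (harmMean v A B) : Matrix (Fin n) (Fin n) ℂ)⁻¹ʳ ≤ (m + M) • 1 := by
    have hA' := smul_le_smul_of_nonneg_left (add_smul_ringInverse_le hm hA₁ hA₂)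
      (sub_nonneg.2 hv₁)
    have hB' := smul_le_smul_of_nonneg_left (add_smul_ringInverse_le hm hB₁ hB₂) hv₀
    have h1 := smul_le_smul_of_nonneg_left hTinv (inv_nonneg.2 ht'.le)
    rw [smul_smul, inv_mul_cancel₀ ht'.ne', one_smul] at h1
    refine (add_le_add (smul_le_smul_of_nonneg_left hP (mul_pos hm hM).le) h1).trans ?_
    refine le_of_eq_of_le ?_ ((add_le_add hA' hB').trans_eq ?_) <;> module
  have hΦkey := OrderHomClass.mono Φ key
  rw [map_add, map_real_smul_matrix, map_real_smul_matrix, map_real_smul_matrix, hΦ] at hΦkey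
  have hQ := map_isStrictlyPositive Φ hΦ hT
  have hchoi := ringInverse_map_le_map_ringInverse Φ hΦ hT
  -- Here `b = (1 + t²)⁻¹`, so the Kantorovich constant is multiplied by `1 + t²`.
  have h := sq_le_smul_sq_of_smul_add_smul_inverse_le (map_nonneg Φ hpos) hQ (mul_pos hm hM)
    (inv_pos.2 ht') (add_pos hm hM)
    ((add_le_add_right (smul_le_smul_of_nonneg_left hchoi (by positivity)) _).trans hΦkey)
  convert h using 3
  rw [kantorovich]
  field_simp
  ring

end Main

theorem mainTheorem1 {n : ℕ}
    {𝒜 : Type*} [CStarAlgebra 𝒜] [PartialOrder 𝒜] [StarOrderedRing 𝒜]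
    (Φ : Matrix (Fin n) (Fin n) ℂ →ₚ[ℂ] 𝒜) (hΦ : Φ 1 = 1)
    (A B : Matrix (Fin n) (Fin n) ℂ)
    (α : ℝ) (hα₀ : 0 ≤ α) (hα₁ : α < Real.pi / 2)
    (hA : numericalRange A ⊆ sector α) (hB : numericalRange B ⊆ sector α)
    (v : ℝ) (hv₀ : 0 ≤ v) (hv₁ : v ≤ 1)
    (m M : ℝ) (hm : 0 < m) (hmM : m ≤ M) :
    ((m • (1 : Matrix (Fin n) (Fin n) ℂ) ≤ ℜ (A⁻¹) ∧ ℜ (A⁻¹) ≤ M • (1 : Matrix (Fin n) (Fin n) ℂ) ∧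
        m • (1 : Matrix (Fin n) (Fin n) ℂ) ≤ ℜ (B⁻¹) ∧
        ℜ (B⁻¹) ≤ M • (1 : Matrix (Fin n) (Fin n) ℂ)) →
      Φ (ℜ (geomMean v A B)) ^ 2 ≤
        ((1 / Real.cos α) ^ 8 * kantorovich (M / m) ^ 2) • Φ (ℜ (harmMean v A B)) ^ 2) ∧
    ((m • (1 : Matrix (Fin n) (Fin n) ℂ) ≤ ℜ A ∧ ℜ A ≤ M • (1 : Matrix (Fin n) (Fin n) ℂ) ∧
        m • (1 : Matrix (Fin n) (Fin n) ℂ) ≤ ℜ B ∧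
        ℜ B ≤ M • (1 : Matrix (Fin n) (Fin n) ℂ)) →
      ((kantorovich (M / m) ^ 2)⁻¹ * Real.cos α ^ 8) • Φ (ℜ (arithMean v A B)) ^ 2 ≤
        Φ (ℜ (geomMean v A B)) ^ 2) := by
  have hcos : 0 < Real.cos α :=
    Real.cos_pos_of_mem_Ioo ⟨by linarith [Real.pi_pos], hα₁⟩
  have htan : 0 ≤ Real.tan α := Real.tan_nonneg_of_nonneg_of_le_pi_div_two hα₀ hα₁.le
  have hsA := isSectorial_of_numericalRange_subset_sector hA
  have hsB := isSectorial_of_numericalRange_subset_sector hB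
  have hM : 0 < M := hm.trans_le hmM
  have hK : 0 < kantorovich (M / m) := by
    rw [kantorovich]
    positivity
  have hsq : ∀ X : Matrix (Fin n) (Fin n) ℂ, 0 ≤ Φ (ℜ X) ^ 2 := by
    intro X
    have hs : IsSelfAdjoint (Φ (ℜ X : Matrix (Fin n) (Fin n) ℂ)) := (ℜ X).2.map Φ
    rw [sq]
    exact hs.mul_self_nonneg
  constructor
  · rintro ⟨h1, h2, h3, h4⟩
    rw [Matrix.nonsing_inv_eq_ringInverse] at h1 h2 h3 h4
    refine (map_realPart_geomMean_sq_le Φ hΦ htan hsA hsB hv₀ hv₁ hm hmM h1 h2 h3 h4).trans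
      (smul_le_smul_of_nonneg_right ?_ (hsq _))
    have h5 : 1 + Real.tan α ^ 2 = (1 / Real.cos α) ^ 2 := by
      rw [one_div, inv_pow, ← Real.inv_one_add_tan_sq hcos.ne', inv_inv]
    have h6 : 1 ≤ 1 / Real.cos α := by
      rw [le_div_iff₀ hcos, one_mul]
      exact Real.cos_le_one α
    -- The bound obtained has `sec⁴α`; it is relaxed to `sec⁸α` since `sec α ≥ 1`.
    rw [h5, mul_pow, ← pow_mul]
    exact mul_le_mul_of_nonneg_right (pow_le_pow_right₀ h6 (by norm_num)) (by positivity)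
  · rintro ⟨h1, h2, h3, h4⟩
    have h := map_realPart_arithMean_sq_le Φ hΦ hv₀ hv₁ hm hmM h1 h2 h3 h4
    have h5 := smul_le_smul_of_nonneg_left h (by positivity : 0 ≤ (kantorovich (M / m) ^ 2)⁻¹)
    rw [smul_smul, inv_mul_cancel₀ (by positivity), one_smul] at h5
    refine (smul_le_smul_of_nonneg_right ?_ (hsq _)).trans h5
    exact mul_le_of_le_one_right (by positivity) (pow_le_one₀ hcos.le (Real.cos_le_one α))
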